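/- Let $m\ge 3$ be an odd integer and let $n\ge 15$ be an integer such that $m=3$ or $n\ge m^4$. Then there is a space-optimal $2$-Gray code $C$ over $\mathbb{Z}_m^n$, that is, a cyclic sequence $C=(w_1,\dots,w_{m^n})$ in which every word of $\mathbb{Z}_m^n$ occurs exactly once and in which any two cyclically consecutive words differ in at most $2$ coordinates, such that each of the two functions $next(C,\cdot)$ and $prev(C,\cdot)$, which send a word to the word that follows it, respectively precedes it, in the cyclic sequence, is computed by a decision assignment tree $T$ with $\mathrm{READ}(T)\le 4\log_m n$ and $\mathrm{WRITE}(T)\le 2$. Here a decision assignment tree over $\mathbb{Z}_m^n$ is a finite rooted tree in which each internal node is labelled by one of the variables $x_1,\dots,x_n$ and has $m$ outgoing edges, labelled by the distinct elements of $\mathbb{Z}_m$, and each leaf is labelled by a set of instructions that assign fixed values to some of the variables (at most one instruction per variable). On an input $\langle x_1,\dots,x_n\rangle$ the execution starts at the root, follows at each internal node the edge labelled by the value of the queried variable, and on reaching a leaf performs the assignments of that leaf; the modified vector is the output. $\mathrm{READ}(T)$ is the maximum number of internal nodes on a path from the root to a leaf, and $\mathrm{WRITE}(T)$ is the maximum number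 of assignment instructions in a leaf. -/

import Mathlib

/-- A counter over a domain `D`: a cyclic sequence `(word 0, …, word (len - 1))` of distinct
elements of `D`. -/
structure Counter (D : Type) where
  len : ℕ
  len_pos : 0 < len
  word : Fin len → D
  word_injective : Function.Injective word

namespace Counter

variable {D : Type}

/-- The cyclic successor of a position. -/
def succIdx (C : Counter D) (i : Fin C.len) : Fin C.len :=
  ⟨((i : ℕ) + 1) % C.len, Nat.mod_lt _ C.len_pos⟩

/-- The cyclic predecessor of a position. -/
def predIdx (C : Counter D) (i : Fin C.len) : Fin C.len :=
  ⟨((i : ℕ) + (C.len - 1)) % C.len, Nat.mod_lt _ C.len_pos⟩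

theorem succIdx_predIdx (C : Counter D) (i : Fin C.len) : C.succIdx (C.predIdx i) = i := by
  have hi := i.isLt
  have hl := C.len_pos
  apply Fin.ext
  simp only [succIdx, predIdx]
  rw [Nat.mod_add_mod, Nat.add_assoc, Nat.sub_add_cancel hl, Nat.add_mod_right,
    Nat.mod_eq_of_lt hi]

/-- The position of a word that occurs in the counter. -/
noncomputable def index (C : Counter D) (w : Set.range C.word) : Fin C.len :=
  Classical.choose w.2

theorem word_index (C : Counter D) (w : Set.range C.word) : C.word (C.index w) = w.1 :=
  Classical.choose_spec w.2

/-- The word that follows `w` in the cyclic sequence. -/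
noncomputable def next (C : Counter D) (w : Set.range C.word) : D :=
  C.word (C.succIdx (C.index w))

/-- The word that precedes `w` in the cyclic sequence. -/
noncomputable def prev (C : Counter D) (w : Set.range C.word) : D :=
  C.word (C.predIdx (C.index w))

theorem next_word (C : Counter D) (i : Fin C.len) :
    C.next ⟨C.word i, i, rfl⟩ = C.word (C.succIdx i) := by
  have h := C.word_injective (C.word_index ⟨C.word i, i, rfl⟩)
  simp only [next, h]

theorem prev_word (C : Counter D) (i : Fin C.len) :
    C.prev ⟨C.word i, i, rfl⟩ = C.word (C.predIdx i) := by
  have h := C.word_injective (C.word_index ⟨C.word i, i, rfl⟩)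
  simp only [prev, h]

/-- A counter is space-optimal if its length is the size of the domain. -/
def SpaceOptimal (C : Counter D) : Prop :=
  C.len = Nat.card D

/-- A counter over `A ^ n` is a `c`-Gray code if any two cyclically consecutive words differ in
at most `c` coordinates. -/
def IsGrayCode {A : Type} [DecidableEq A] {n : ℕ} (c : ℕ) (C : Counter (Fin n → A)) : Prop :=
  ∀ i : Fin C.len, hammingDist (C.word i) (C.word (C.succIdx i)) ≤ c

end Counter

/-- Decision assignment trees over the domain `A ^ n`. An internal node queries a variable and has
one child for each element of `A`; a leaf carries a set of assignment instructions, at most one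
for each variable: `some a` sets the variable to `a`, `none` leaves it unchanged. -/
inductive DAT (A : Type) (n : ℕ) : Type where
  | leaf (assign : Fin n → Option A) : DAT A n
  | node (var : Fin n) (child : A → DAT A n) : DAT A n

namespace DAT

variable {A : Type} {n : ℕ}

/-- The output of the execution of a tree on an input vector. -/
def run : DAT A n → (Fin n → A) → (Fin n → A)
  | leaf assign, x => fun i => (assign i).getD (x i)
  | node var child, x => run (child (x var)) x

/-- Read complexity: the maximum number of internal nodes on a path from the root to a leaf. -/
def read [Fintype A] : DAT A n → ℕ
  | leaf _ => 0
  | node _ child => 1 + Finset.univ.sup fun a => read (child a)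

/-- Write complexity: the maximum number of assignment instructions in a leaf. -/
def write [Fintype A] : DAT A n → ℕ
  | leaf assign => (Finset.univ.filter fun i => (assign i).isSome).card
  | node _ child => Finset.univ.sup fun a => write (child a)

/-- The tree computes the function `next` of the counter. -/
def ComputesNext (T : DAT A n) (C : Counter (Fin n → A)) : Prop :=
  ∀ w : Set.range C.word, T.run w.1 = C.next w

/-- The tree computes the function `prev` of the counter. -/
def ComputesPrev (T : DAT A n) (C : Counter (Fin n → A)) : Prop :=
  ∀ w : Set.range C.word, T.run w.1 = C.prev w

end DAT

/-! Split the coordinates into a pointer block of `r` and a data block of `N = M + 1`. The pointer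
runs through a one-coordinate Gray code. Each pointer value selects a permutation of the data block
that rewrites one coordinate as a function of itself and at most two others. A step therefore reads
`r + 3` coordinates and writes 2, and so does its inverse. If the selected permutations, composed
over one round of the pointer, give a full cycle of the data block, then the whole map is a full
cycle (`IsFullCycle.prodShear`).

That composite is the odometer, so the odometer must be a product of at most `m ^ r` local
permutations (`odometer_mem_localPerms_pow`). The carry into digit `j` is a product of `j`
one-coordinate indicators. As for Barrington's theorem, adding a product to a coordinate is a
commutator of two additions of about half as many factors each, so its cost is quadratic in `j`
(`shear_coordProd_mem`). This borrows one spare coordinate, which the top digit lacks; there the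
oddness of `m` helps, since 2 is then a unit (`shear_zeroTest_mem`). The total is cubic in `M`,
while `r + 3 = ⌊4 log_m n⌋` makes `m ^ r` large enough (`exists_pointer_size`). -/

open Equiv Function

/-! ### Full cycles, skew products and counters -/

section FullCycle

variable {α β : Type*}

/-- A permutation one of whose forward orbits is everything. -/
def IsFullCycle (f : Perm α) : Prop :=
  ∃ x₀, ∀ y, ∃ k : ℕ, (f ^ k) x₀ = y

theorem IsFullCycle.isCycleOn [Fintype α] {f : Perm α} (hf : IsFullCycle f) :
    f.IsCycleOn ((Finset.univ : Finset α) : Set α) := by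
  obtain ⟨x₀, h⟩ := hf
  have h' : ∀ y, f.SameCycle x₀ y := fun y => by
    obtain ⟨k, hk⟩ := h y
    exact ⟨k, by simpa using hk⟩
  rw [Finset.coe_univ]
  exact ⟨Set.bijOn_univ.2 f.bijective, fun x _ y _ => (h' x).symm.trans (h' y)⟩

theorem IsFullCycle.exists_pow_eq [Fintype α] {f : Perm α} (hf : IsFullCycle f) (x y : α) :
    ∃ k < Fintype.card α, (f ^ k) x = y := by
  simpa using hf.isCycleOn.exists_pow_eq (Finset.mem_univ x) (Finset.mem_univ y)

theorem IsFullCycle.pow_card_apply [Fintype α] {f : Perm α} (hf : IsFullCycle f) (x : α) :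
    (f ^ Fintype.card α) x = x := by
  simpa using hf.isCycleOn.pow_card_apply (Finset.mem_univ x)

theorem IsFullCycle.pow_apply_inj [Fintype α] {f : Perm α} (hf : IsFullCycle f) (x : α) {i j : ℕ}
    (hi : i < Fintype.card α) (hj : j < Fintype.card α) (h : (f ^ i) x = (f ^ j) x) : i = j := by
  have := (hf.isCycleOn.pow_apply_eq_pow_apply (Finset.mem_univ x)).1 h
  rw [Finset.card_univ] at this
  exact Nat.ModEq.eq_of_lt_of_lt this hi hj

theorem pow_apply_semiconj {f : Perm α} {g : Perm β} (e : α → β) (h : ∀ x, e (f x) = g (e x))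
    (k : ℕ) (x : α) : e ((f ^ k) x) = (g ^ k) (e x) := by
  induction k with
  | zero => rfl
  | succ k ih => rw [pow_succ', pow_succ', Perm.mul_apply, Perm.mul_apply, h, ih]

theorem IsFullCycle.of_semiconj {f : Perm α} {g : Perm β} (hf : IsFullCycle f) (e : α ≃ β)
    (h : ∀ x, e (f x) = g (e x)) : IsFullCycle g := by
  obtain ⟨x₀, hx⟩ := hf
  refine ⟨e x₀, fun y => ?_⟩
  obtain ⟨k, hk⟩ := hx (e.symm y)
  exact ⟨k, by rw [← pow_apply_semiconj e h, hk, e.apply_symm_apply]⟩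

/-- A skew product over a full cycle is a full cycle as soon as its first return map to one fibre
is. -/
theorem IsFullCycle.prodShear [Fintype α] {g : Perm α} (hg : IsFullCycle g) (S : α → Perm β)
    (p₀ : α) (T : ℕ → Perm β) (hT0 : T 0 = 1)
    (hT : ∀ k < Fintype.card α, T (k + 1) = S ((g ^ k) p₀) * T k)
    (hcyc : IsFullCycle (T (Fintype.card α))) :
    IsFullCycle (Equiv.prodShear g S : Perm (α × β)) := by
  obtain ⟨x₀, hx⟩ := hcyc
  set f : Perm (α × β) := Equiv.prodShear g S with hf
  have step : ∀ k ≤ Fintype.card α, ∀ x, (f ^ k) (p₀, x) = ((g ^ k) p₀, T k x) := by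
    intro k
    induction k with
    | zero => intro _ x; simp [hT0]
    | succ k ih =>
      intro hk x
      rw [pow_succ', Perm.mul_apply, ih (by omega), hf, Equiv.prodShear_apply, hT k (by omega),
        pow_succ' g, Perm.mul_apply, Perm.mul_apply]
  -- `T (Fintype.card α)` is the first return map to the fibre over `p₀`.
  have ret : ∀ q x, (f ^ (Fintype.card α * q)) (p₀, x) = (p₀, (T (Fintype.card α) ^ q) x) := by
    intro q
    induction q with
    | zero => intro x; rfl
    | succ q ih =>
      intro x
      rw [Nat.mul_succ, Nat.add_comm, pow_add, Perm.mul_apply, ih, step _ le_rfl,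
        hg.pow_card_apply, pow_succ', Perm.mul_apply]
  refine ⟨(p₀, x₀), fun ⟨p, y⟩ => ?_⟩
  obtain ⟨s, hs, rfl⟩ := hg.exists_pow_eq p₀ p
  obtain ⟨q, hq⟩ := hx ((T s).symm y)
  exact ⟨s + Fintype.card α * q, by
    rw [pow_add, Perm.mul_apply, ret, step s hs.le, hq, Equiv.apply_symm_apply]⟩

/-- The counter that runs through a full cycle. -/
theorem IsFullCycle.exists_counter {D : Type} [Fintype D] {f : Perm D} (hf : IsFullCycle f) :
    ∃ C : Counter D, C.SpaceOptimal ∧ (∀ w, C.next w = f w.1) ∧ (∀ w, C.prev w = f⁻¹ w.1) := by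
  obtain ⟨x₀, -⟩ := id hf
  have hpos : 0 < Fintype.card D := Fintype.card_pos_iff.2 ⟨x₀⟩
  let C : Counter D :=
    { len := Fintype.card D
      len_pos := hpos
      word := fun i => (f ^ (i : ℕ)) x₀
      word_injective := fun i j h => Fin.ext (hf.pow_apply_inj x₀ i.2 j.2 h) }
  have hsucc : ∀ i, C.word (C.succIdx i) = f (C.word i) := by
    intro i
    change (f ^ (((i : ℕ) + 1) % Fintype.card D)) x₀ = f ((f ^ (i : ℕ)) x₀)
    rw [← Perm.mul_apply, ← pow_succ']
    refine (hf.isCycleOn.pow_apply_eq_pow_apply (Finset.mem_univ x₀)).2 ?_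
    rw [Finset.card_univ]
    exact Nat.mod_modEq _ _
  refine ⟨C, (Nat.card_eq_fintype_card).symm, fun w => ?_, fun w => ?_⟩
  · rw [Counter.next, hsucc, C.word_index]
  · rw [Counter.prev, Perm.eq_inv_iff_eq, ← hsucc, C.succIdx_predIdx, C.word_index]

end FullCycle

/-! ### The odometer -/

section Odometer

variable {m : ℕ}

/-- The carry into digit `i` when a base `m` number is incremented. -/
def carry {N : ℕ} (x : Fin N → ZMod m) (i : ℕ) : ZMod m :=
  if ∀ k : Fin N, (k : ℕ) < i → x k = -1 then 1 else 0

/-- Increment of a base `m` number, least significant digit first. -/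
def increment {N : ℕ} (x : Fin N → ZMod m) (i : Fin N) : ZMod m :=
  x i + carry x i

theorem carry_eq_one_of_lt {N : ℕ} {x : Fin N → ZMod m} {i j : ℕ} (hij : i ≤ j)
    (h : carry x j ≠ 0) : carry x i = 1 := by
  unfold carry at *
  rw [if_pos]
  by_contra h'
  apply h
  rw [if_neg]
  exact fun h'' => h' fun k hk => h'' k (by omega)

/-- The digits below `j` can become zero only by a carry running through all of them. Hence a carry
can be read off from digits that are already incremented. -/
theorem increment_eq_zero_iff {N : ℕ} (x : Fin N → ZMod m) (j : ℕ) :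
    (∀ k : Fin N, (k : ℕ) < j → increment x k = 0) ↔ ∀ k : Fin N, (k : ℕ) < j → x k = -1 := by
  constructor
  · intro h k
    induction hk : (k : ℕ) using Nat.strong_induction_on generalizing k with
    | _ a ih =>
      intro hkj
      have h1 := h k (by omega)
      rw [increment, carry, if_pos] at h1
      · exact eq_neg_of_add_eq_zero_left h1
      · exact fun l hl => ih l (by omega) l rfl (by omega)
  · intro h k hk
    rw [increment, carry, if_pos, h k hk, neg_add_cancel]
    exact fun l hl => h l (by omega)

theorem increment_injective {N : ℕ} : Injective (increment : (Fin N → ZMod m) → _) := by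
  intro x y h
  have key : ∀ a : ℕ, carry x a = carry y a := fun a => by
    unfold carry
    simp only [← increment_eq_zero_iff, h]
  funext i
  have := congrFun h i
  rw [increment, increment, key] at this
  exact add_right_cancel this

/-- The permutation that increments a base `m` number. -/
noncomputable def odometer (m N : ℕ) [NeZero m] : Perm (Fin N → ZMod m) :=
  Equiv.ofBijective increment (Finite.injective_iff_bijective.1 increment_injective)

theorem odometer_apply [NeZero m] {N : ℕ} (x : Fin N → ZMod m) : odometer m N x = increment x :=
  rfl

theorem isFullCycle_addRight_one [NeZero m] : IsFullCycle (Equiv.addRight (1 : ZMod m)) := by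
  have key : ∀ k : ℕ, (Equiv.addRight (1 : ZMod m) ^ k) 0 = k := by
    intro k
    induction k with
    | zero => simp
    | succ k ih => rw [pow_succ', Perm.mul_apply, ih, Equiv.coe_addRight, Nat.cast_succ]
  exact ⟨0, fun y => ⟨y.val, by rw [key, ZMod.natCast_zmod_val]⟩⟩

/-- The top digit is the fibre of a skew product over the lower `N` digits. These overflow exactly
once per round, so the first return map adds 1 to the top digit. -/
theorem isFullCycle_odometer [NeZero m] (N : ℕ) : IsFullCycle (odometer m N) := by
  induction N with
  | zero => exact ⟨0, fun y => ⟨0, Subsingleton.elim _ _⟩⟩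
  | succ N ih =>
    let S : (Fin N → ZMod m) → Perm (ZMod m) := fun p =>
      Equiv.addRight (carry p N)
    let K := Fintype.card (Fin N → ZMod m)
    have hK : 0 < K := Fintype.card_pos
    have hcarry : ∀ p : Fin N → ZMod m, carry p N = if odometer m N p = 0 then 1 else 0 := by
      intro p
      unfold carry
      simp only [← increment_eq_zero_iff, odometer_apply, funext_iff, Pi.zero_apply]
      congr 1
      simp
    have hfull := ih.prodShear S 0 (fun k => if k < K then 1 else Equiv.addRight 1)
      (by simp [hK]) (fun k hk => by
        -- Overflow happens only at the step that returns to 0, the last one of the round.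
        have hS : S ((odometer m N ^ k) 0) = if k + 1 = K then Equiv.addRight 1 else 1 := by
          simp only [S, hcarry]
          rw [← Perm.mul_apply, ← pow_succ']
          by_cases h : k + 1 = K
          · rw [if_pos h, if_pos]
            rw [h]; exact ih.pow_card_apply 0
          · rw [if_neg h, if_neg]
            · ext; simp
            · intro h0
              have := ih.pow_apply_inj 0 (i := k + 1) (j := 0)
                (lt_of_le_of_ne hk h) hK h0
              omega
        rw [hS]
        have hk' : k < K := hk
        by_cases h : k + 1 = K
        · rw [if_pos h, if_pos hk', if_neg (by omega), mul_one]
        · rw [if_neg h, if_pos hk', if_pos (by omega), mul_one])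
      (by
        rw [if_neg (lt_irrefl _)]
        exact isFullCycle_addRight_one)
    refine hfull.of_semiconj
      ((Equiv.prodComm _ _).trans (Fin.snocEquiv fun _ : Fin (N + 1) => ZMod m)) ?_
    rintro ⟨p, b⟩
    have hc : ∀ i ≤ N, carry (Fin.snoc (α := fun _ => ZMod m) p b) i = carry p i := by
      intro i hi
      unfold carry
      congr 1
      rw [Fin.forall_fin_succ']
      simp only [Fin.snoc_castSucc, Fin.val_castSucc, Fin.val_last, eq_iff_iff]
      exact ⟨fun h => h.1, fun h => ⟨h, fun h' => by omega⟩⟩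
    change Fin.snoc (α := fun _ => ZMod m) (increment p) (b + carry p N)
      = increment (Fin.snoc (α := fun _ => ZMod m) p b)
    funext i
    refine Fin.lastCases ?_ (fun i => ?_) i
    · simp only [increment, Fin.snoc_last, Fin.val_last, hc N le_rfl]
    · simp only [increment, Fin.snoc_castSucc, Fin.val_castSucc, hc i i.2.le]

end Odometer

/-! ### The modular Gray code -/

section GrayCode

variable {m : ℕ}

/-- The digit differences `x i - x (i + 1)`, which turn counting into the modular Gray code. -/
def digitDiff {N : ℕ} (x : Fin N → ZMod m) (i : Fin N) : ZMod m :=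
  x i - if h : (i : ℕ) + 1 < N then x ⟨i + 1, h⟩ else 0

theorem digitDiff_injective {N : ℕ} : Injective (digitDiff : (Fin N → ZMod m) → _) := by
  intro x y h
  have key : ∀ d : ℕ, ∀ i : Fin N, N = i + 1 + d → x i = y i := by
    intro d
    induction d with
    | zero =>
      intro i hi
      have := congrFun h i
      simpa [digitDiff, show ¬ (i : ℕ) + 1 < N by omega] using this
    | succ d ih =>
      intro i hi
      have := congrFun h i
      have hlt : (i : ℕ) + 1 < N := by omega
      simpa [digitDiff, hlt, ih ⟨i + 1, hlt⟩ (by simp only; omega)] using this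
  funext i
  exact key (N - (i + 1)) i (by omega)

/-- The modular Gray code as a permutation. -/
theorem exists_gray_perm [NeZero m] {r : ℕ} (hr : 0 < r) :
    ∃ g : Perm (Fin r → ZMod m), IsFullCycle g ∧
      (∀ p, ∃ i, ∃ a, g p = update p i a) ∧ (∀ p, ∃ i, ∃ a, g⁻¹ p = update p i a) := by
  let L : Perm (Fin r → ZMod m) :=
    Equiv.ofBijective digitDiff (Finite.injective_iff_bijective.1 digitDiff_injective)
  have main : ∀ x : Fin r → ZMod m, ∃ i, ∀ j, j ≠ i →
      digitDiff (increment x) j = digitDiff x j := by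
    intro x
    by_contra! H
    -- A difference changes only where the carries into neighbouring digits differ, which is at the
    -- highest digit that receives a carry.
    have key : ∀ j, digitDiff (increment x) j ≠ digitDiff x j →
        carry x j = 1 ∧ ∀ i : Fin r, j < i → carry x i = 0 := by
      intro j hj
      by_cases hlt : (j : ℕ) + 1 < r
      · have hne : carry x j ≠ carry x (j + 1) := by
          intro heq
          apply hj
          simp only [digitDiff, increment, hlt, dif_pos, heq]
          ring
        have h0 : carry x (j + 1) = 0 := by
          by_contra h0
          have e1 := carry_eq_one_of_lt (Nat.le_succ j) h0
          have e2 := carry_eq_one_of_lt le_rfl h0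
          exact hne (e1.trans e2.symm)
        refine ⟨carry_eq_one_of_lt le_rfl (h0 ▸ hne), fun i hi => ?_⟩
        by_contra h1
        have := carry_eq_one_of_lt (show (j : ℕ) + 1 ≤ i from hi) h1
        rw [h0] at this
        -- Here `0 = 1` in `ZMod m`, which happens for `m = 1`; all elements are then equal.
        exact h1 (by rw [← mul_one (carry x i), ← this, mul_zero])
      · refine ⟨carry_eq_one_of_lt le_rfl fun h0 => hj ?_, fun i hi => ?_⟩
        · simp [digitDiff, increment, hlt, h0]
        · have : (j : ℕ) < i := hi
          omega
    obtain ⟨i, -, hi⟩ := H ⟨0, hr⟩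
    obtain ⟨j, hji, hj⟩ := H i
    have aux : ∀ i j, digitDiff (increment x) i ≠ digitDiff x i →
        digitDiff (increment x) j ≠ digitDiff x j → i < j → False := by
      intro i j hi hj hij
      have h1 := (key j hj).1
      rw [(key i hi).2 j hij] at h1
      apply hi
      rw [← mul_one (digitDiff (increment x) i), ← h1, mul_zero, ← mul_one (digitDiff x i), ← h1,
        mul_zero]
    rcases lt_or_gt_of_ne hji with h | h
    · exact aux j i hj hi h
    · exact aux i j hi hj h
  let g : Perm (Fin r → ZMod m) := L * odometer m r * L⁻¹
  have hg : ∀ x, g (L x) = L (increment x) := fun x => by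
    simp [g, odometer_apply]
  refine ⟨g, (isFullCycle_odometer r).of_semiconj L fun x => ?_, fun p => ?_, fun p => ?_⟩
  · rw [hg]; rfl
  · obtain ⟨x, rfl⟩ := L.surjective p
    obtain ⟨i, hi⟩ := main x
    refine ⟨i, g (L x) i, ?_⟩
    rw [eq_update_iff]
    exact ⟨rfl, fun j hj => by rw [hg]; exact hi j hj⟩
  · obtain ⟨q, rfl⟩ := g.surjective p
    obtain ⟨x, rfl⟩ := L.surjective q
    obtain ⟨i, hi⟩ := main x
    refine ⟨i, L x i, ?_⟩
    rw [show g⁻¹ (g (L x)) = L x from g.symm_apply_apply _, eq_update_iff]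
    exact ⟨rfl, fun j hj => by rw [hg]; exact (hi j hj).symm⟩

end GrayCode

/-! ### Building shallow decision assignment trees -/

namespace DAT

section

variable {A : Type} {n : ℕ}

/-- The tree that queries the variables `c 0, …, c (r - 1)` and continues with the tree that the
answers select. -/
def queries : {r : ℕ} → (Fin r → Fin n) → ((Fin r → A) → DAT A n) → DAT A n
  | 0, _, k => k Fin.elim0
  | _ + 1, c, k => node (c 0) fun a => queries (Fin.tail c) fun v => k (Fin.cons a v)

theorem run_queries {r : ℕ} (c : Fin r → Fin n) (k : (Fin r → A) → DAT A n) (x : Fin n → A) :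
    (queries c k).run x = (k (x ∘ c)).run x := by
  induction r with
  | zero =>
    rw [queries]
    congr 2
    exact Subsingleton.elim _ _
  | succ r ih =>
    rw [queries, run, ih]
    congr 2
    rw [← Fin.cons_self_tail (x ∘ c)]
    rfl

theorem read_queries_le [Fintype A] {r : ℕ} (c : Fin r → Fin n) (k : (Fin r → A) → DAT A n)
    {b : ℕ} (hk : ∀ v, (k v).read ≤ b) : (queries c k).read ≤ r + b := by
  induction r with
  | zero => simpa [queries] using hk _
  | succ r ih =>
    rw [queries, read, Nat.add_right_comm, Nat.add_comm]
    exact Nat.add_le_add_right (Finset.sup_le fun a _ => ih _ _ fun v => hk _) _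

theorem write_queries_le [Fintype A] {r : ℕ} (c : Fin r → Fin n) (k : (Fin r → A) → DAT A n)
    {b : ℕ} (hk : ∀ v, (k v).write ≤ b) : (queries c k).write ≤ b := by
  induction r with
  | zero => simpa [queries] using hk _
  | succ r ih =>
    rw [queries, write]
    exact Finset.sup_le fun a _ => ih _ _ fun v => hk _

theorem hammingDist_run_le_write [Fintype A] [DecidableEq A] (T : DAT A n) (x : Fin n → A) :
    hammingDist x (T.run x) ≤ T.write := by
  induction T with
  | leaf assign =>
    rw [run, write, hammingDist]
    refine Finset.card_le_card fun i => ?_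
    simp only [Finset.mem_filter, Finset.mem_univ, true_and]
    cases assign i <;> simp
  | node var child ih =>
    rw [run, write]
    exact (ih _).trans (Finset.le_sup (f := fun a => (child a).write) (Finset.mem_univ _))

/-- A map that rewrites one coordinate of the first block as a function of that block, and one
coordinate of the second block as a function of the first block and of three coordinates of the
second, is computed by a shallow tree. -/
theorem exists_dat_append [Fintype A] {r N : ℕ}
    (F : (Fin r → A) → (Fin N → A) → (Fin r → A) × (Fin N → A))
    (hF : ∀ p, ∃ i, ∃ a, ∃ t c d, ∃ φ : A → A → A → A, ∀ x,
      F p x = (update p i a, update x t (φ (x t) (x c) (x d)))) :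
    ∃ T : DAT A (r + N), (∀ p x, T.run (Fin.append p x) = Fin.append (F p x).1 (F p x).2) ∧
      T.read ≤ r + 3 ∧ T.write ≤ 2 := by
  classical
  choose i a t c d φ hF using hF
  -- The three data coordinates queried depend on the pointer value already read.
  let T : DAT A (r + N) := queries (Fin.castAdd N) fun p =>
    queries ![Fin.natAdd r (t p), Fin.natAdd r (c p), Fin.natAdd r (d p)] fun v =>
      leaf fun j =>
        if j = Fin.castAdd N (i p) then some (a p)
        else if j = Fin.natAdd r (t p) then some (φ p (v 0) (v 1) (v 2)) else none
  refine ⟨T, fun p x => ?_, ?_, ?_⟩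
  · have hp : Fin.append p x ∘ Fin.castAdd N = p := by
      funext j; simp
    simp only [T, run_queries, hp]
    rw [run, hF]
    funext j
    refine Fin.addCases (fun j => ?_) (fun j => ?_) j
    · by_cases h : j = i p
      · subst h; simp
      · have : Fin.castAdd N j ≠ Fin.natAdd r (t p) := by
          intro h'
          have := congrArg Fin.val h'
          simp at this
          omega
        simp [h, this]
    · have h1 : Fin.natAdd r j ≠ Fin.castAdd N (i p) := by
        intro h'
        have := congrArg Fin.val h'
        simp at this
        omega
      by_cases h : j = t p
      · subst h; simp [h1]
      · simp [h, h1]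
  · exact read_queries_le _ _ fun p => read_queries_le _ _ (b := 0) fun v => le_rfl
  · refine write_queries_le _ _ fun p => write_queries_le _ _ fun v => ?_
    rw [write]
    refine (Finset.card_le_card (t := {Fin.castAdd N (i p), Fin.natAdd r (t p)})
      fun j => ?_).trans Finset.card_le_two
    simp only [Finset.mem_filter, Finset.mem_univ, true_and, Finset.mem_insert,
      Finset.mem_singleton]
    split_ifs with h1 h2
    · simp [h1]
    · simp [h2]
    · simp

end

end DAT

/-! ### Local permutations and their products -/

section LocalPerms

open scoped Pointwise commutatorElement

variable {ι R : Type*} [DecidableEq ι]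

/-- A map that rewrites one coordinate as a function of itself and of two coordinates. -/
def IsLocalMap (f : (ι → R) → ι → R) : Prop :=
  ∃ t c d, ∃ φ : R → R → R → R, ∀ x, f x = update x t (φ (x t) (x c) (x d))

variable (ι R) in
/-- The permutations that are local together with their inverses. -/
def localPerms : Set (Perm (ι → R)) :=
  {σ | IsLocalMap σ ∧ IsLocalMap ⇑σ⁻¹}

/-- Identity factors pad a product to any greater length, in particular to exactly `m ^ r`. -/
theorem one_mem_localPerms [Nonempty ι] : 1 ∈ localPerms ι R := by
  obtain ⟨t⟩ := ‹Nonempty ι›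
  exact ⟨⟨t, t, t, fun a _ _ => a, fun x => by simp⟩, ⟨t, t, t, fun a _ _ => a, fun x => by simp⟩⟩

theorem inv_localPerms : (localPerms ι R)⁻¹ = localPerms ι R := by
  ext σ
  simp only [localPerms, Set.mem_inv, Set.mem_ofPred_eq, inv_inv, and_comm]

theorem inv_mem_localPerms_pow {σ : Perm (ι → R)} {k : ℕ} (h : σ ∈ localPerms ι R ^ k) :
    σ⁻¹ ∈ localPerms ι R ^ k := by
  rw [← inv_localPerms, inv_pow]
  exact Set.inv_mem_inv.2 h

theorem commutator_mem_localPerms_pow {σ τ : Perm (ι → R)} {j k : ℕ}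
    (hσ : σ ∈ localPerms ι R ^ j) (hτ : τ ∈ localPerms ι R ^ k) :
    ⁅σ, τ⁆ ∈ localPerms ι R ^ (2 * j + 2 * k) := by
  rw [commutatorElement_def, show 2 * j + 2 * k = j + k + j + k by omega, pow_add, pow_add, pow_add]
  exact Set.mul_mem_mul (Set.mul_mem_mul (Set.mul_mem_mul hσ hτ) (inv_mem_localPerms_pow hσ))
    (inv_mem_localPerms_pow hτ)

theorem localPerms_pow_mono [Nonempty ι] {σ : Perm (ι → R)} {j k : ℕ} (hjk : j ≤ k)
    (h : σ ∈ localPerms ι R ^ j) : σ ∈ localPerms ι R ^ k :=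
  Set.pow_subset_pow_right one_mem_localPerms hjk h

end LocalPerms

/-! ### Products of one-coordinate functions -/

section CoordProd

variable {ι R : Type*} [CommRing R]

/-- A product of functions of single coordinates. -/
def coordProd (J : Finset ι) (h : ι → R → R) (x : ι → R) : R :=
  ∏ i ∈ J, h i (x i)

variable [DecidableEq R]

/-- The indicator function of zero. -/
def zeroIndicator (a : R) : R :=
  if a = 0 then 1 else 0

/-- The indicator function of the vanishing of all coordinates in `J`. -/
def zeroTest (J : Finset ι) : (ι → R) → R :=
  coordProd J fun _ => zeroIndicator

theorem zeroTest_apply (J : Finset ι) (x : ι → R) :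
    zeroTest J x = if ∀ i ∈ J, x i = 0 then 1 else 0 := by
  simp only [zeroTest, coordProd, zeroIndicator, Finset.prod_ite_zero, Finset.prod_const_one]

end CoordProd

/-! ### Shears, scalings and their commutators -/

section Shear

open scoped Pointwise commutatorElement

variable {ι R : Type*} [DecidableEq ι] [CommRing R] {β : Type*}

/-- The function `φ` ignores the coordinate `t`. -/
def IgnoresCoord (t : ι) (φ : (ι → R) → β) : Prop :=
  ∀ x v, φ (update x t v) = φ x

/-- Add to the coordinate `t` a function of the other coordinates. -/
def shear (t : ι) (φ : (ι → R) → R) : Perm (ι → R) where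
  -- Evaluating `φ` with coordinate `t` reset to 0 makes the map invertible for every `φ`.
  toFun x := update x t (x t + φ (update x t 0))
  invFun x := update x t (x t - φ (update x t 0))
  left_inv x := by simp
  right_inv x := by simp

/-- Multiply the coordinate `t` by a unit that depends on the other coordinates. -/
def scale (t : ι) (u : (ι → R) → Rˣ) : Perm (ι → R) where
  toFun x := update x t (u (update x t 0) * x t)
  invFun x := update x t (((u (update x t 0))⁻¹ : Rˣ) * x t)
  left_inv x := by simp
  right_inv x := by simp

theorem shear_apply {t : ι} {φ : (ι → R) → R} (hφ : IgnoresCoord t φ) (x : ι → R) :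
    shear t φ x = update x t (x t + φ x) := by
  change update x t (x t + φ (update x t 0)) = _
  rw [hφ]

theorem shear_inv_apply {t : ι} {φ : (ι → R) → R} (hφ : IgnoresCoord t φ) (x : ι → R) :
    (shear t φ)⁻¹ x = update x t (x t - φ x) := by
  change update x t (x t - φ (update x t 0)) = _
  rw [hφ]

theorem scale_apply {t : ι} {u : (ι → R) → Rˣ} (hu : IgnoresCoord t u) (x : ι → R) :
    scale t u x = update x t (u x * x t) := by
  change update x t (u (update x t 0) * x t) = _
  rw [hu]

theorem scale_inv_apply {t : ι} {u : (ι → R) → Rˣ} (hu : IgnoresCoord t u) (x : ι → R) :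
    (scale t u)⁻¹ x = update x t (((u x)⁻¹ : Rˣ) * x t) := by
  change update x t (((u (update x t 0))⁻¹ : Rˣ) * x t) = _
  rw [hu]

theorem commutator_eq_of_mul_eq {G : Type*} [Group G] {a b c : G} (h : a * b = c * (b * a)) :
    ⁅a, b⁆ = c := by
  rw [commutatorElement_def, h]
  group

/-- Adding `F` to `x y` before rather than after adding `x y * G` to `x t` changes the latter by `F
* G`. The value of `x y` is arbitrary and is restored. -/
theorem commutator_shear_shear {t y : ι} (hty : y ≠ t) {F G : (ι → R) → R}
    (hFt : IgnoresCoord t F) (hFy : IgnoresCoord y F) (hGt : IgnoresCoord t G)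
    (hGy : IgnoresCoord y G) :
    ⁅shear t (fun x => x y * G x), shear y F⁆ = shear t (fun x => F x * G x) := by
  have h1 : IgnoresCoord t (fun x => x y * G x) := fun x v => by
    simp only [update_of_ne hty, hGt x v]
  have h2 : IgnoresCoord t (fun x => F x * G x) := fun x v => by
    simp only [hFt x v, hGt x v]
  apply commutator_eq_of_mul_eq
  ext x i
  simp only [Perm.mul_apply, shear_apply h1, shear_apply h2, shear_apply hFy, hFt _ _, hFy _ _,
    hGt _ _, hGy _ _, update_self, update_of_ne hty, update_of_ne hty.symm]
  by_cases hit : i = t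
  · subst hit
    simp only [update_self]
    ring
  · by_cases hiy : i = y
    · subst hiy
      simp [hit]
    · simp [hit, hiy]

theorem commutator_scale_shear_same {b : ι} {u : (ι → R) → Rˣ} {φ : (ι → R) → R}
    (hu : IgnoresCoord b u) (hφ : IgnoresCoord b φ) :
    ⁅scale b u, shear b φ⁆ = shear b (fun x => (u x - 1) * φ x) := by
  have h1 : IgnoresCoord b (fun x => ((u x : R) - 1) * φ x) := fun x v => by
    simp only [hu x v, hφ x v]
  apply commutator_eq_of_mul_eq
  ext x i
  simp only [Perm.mul_apply, shear_apply h1, shear_apply hφ, scale_apply hu, hφ _ _, hu _ _,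
    update_self, update_idem]
  congr 2
  ring

/-- The shear of `a` is undone by the commutator, so only `b` changes: it is scaled once with the
original `x a` and unscaled once with the shifted one. -/
theorem commutator_scale_shear {a b : ι} (hab : a ≠ b) {u : (ι → R) → Rˣ} {f : (ι → R) → R}
    (hu : IgnoresCoord b u) (hfa : IgnoresCoord a f) (hfb : IgnoresCoord b f) :
    ⁅scale b u, shear a f⁆ = scale b (fun x => u x * (u (update x a (x a - f x)))⁻¹) := by
  have h1 : IgnoresCoord b (fun x => u x * (u (update x a (x a - f x)))⁻¹) := fun x v => by
    simp only [hu x v, hfb x v, update_comm hab.symm, update_of_ne hab, hu _ v]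
  have e1 : ∀ (x : ι → R) v w, u (update (update x b v) a w) = u (update x a w) := fun x v w => by
    rw [update_comm hab.symm, hu]
  apply commutator_eq_of_mul_eq
  ext x i
  simp only [Perm.mul_apply, scale_apply h1, shear_apply hfa, scale_apply hu, hfa _ _, hfb _ _,
    update_self, update_idem, update_of_ne hab, update_of_ne hab.symm, add_sub_cancel_right, e1,
    update_eq_self]
  rw [update_comm hab.symm, update_idem, ← mul_assoc, ← Units.val_mul, inv_mul_cancel_right]

theorem shear_mem_localPerms {t c d : ι} {φ : (ι → R) → R} (hφ : IgnoresCoord t φ)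
    (ψ : R → R → R) (h : ∀ x, φ x = ψ (x c) (x d)) : shear t φ ∈ localPerms ι R :=
  ⟨⟨t, c, d, fun a p q => a + ψ p q, fun x => by rw [shear_apply hφ, h]⟩,
    ⟨t, c, d, fun a p q => a - ψ p q, fun x => by rw [shear_inv_apply hφ, h]⟩⟩

theorem ignoresCoord_coordProd {J : Finset ι} {t : ι} (ht : t ∉ J) (h : ι → R → R) :
    IgnoresCoord t (coordProd J h) := fun x v =>
  Finset.prod_congr rfl fun i hi => by
    rw [update_of_ne (ne_of_mem_of_not_mem hi ht)]

/-- A bound for the number of local permutations needed to add a product of `j` functions of single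
coordinates. -/
def shearCost (j : ℕ) : ℕ :=
  max 1 ((3 * (j - 1) ^ 2 - 1) / 2)

/-- With `s = j - 1`, the two halves have parameters `a + b = s` that differ by at most 1. Then `2 *
(a ^ 2 + b ^ 2)` is `s ^ 2` or `s ^ 2 + 1`, and the `- 1` in `shearCost` absorbs the excess. The
factor 3 gives cost 1 for `j = 2`. -/
theorem shearCost_rec {j : ℕ} (hj : 3 ≤ j) :
    2 * shearCost (j / 2 + 1) + 2 * shearCost ((j + 1) / 2) ≤ shearCost j := by
  have aux : ∀ k, shearCost (k + 2) = (3 * (k + 1) ^ 2 - 1) / 2 := fun k => by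
    unfold shearCost
    rw [max_eq_right]
    · rfl
    · change 1 ≤ (3 * (k + 1) ^ 2 - 1) / 2
      have : 1 ≤ (k + 1) ^ 2 := Nat.one_le_pow _ _ (by omega)
      omega
  obtain ⟨k, rfl | rfl⟩ : ∃ k, j = 2 * k + 3 ∨ j = 2 * k + 4 := ⟨(j - 3) / 2, by omega⟩
  · rw [show (2 * k + 3) / 2 + 1 = k + 2 by omega, show (2 * k + 3 + 1) / 2 = k + 2 by omega,
      show 2 * k + 3 = (2 * k + 1) + 2 by omega, aux, aux]
    have : (2 * k + 1 + 1) ^ 2 = 4 * (k + 1) ^ 2 := by ring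
    have : 1 ≤ (k + 1) ^ 2 := Nat.one_le_pow _ _ (by omega)
    omega
  · rw [show (2 * k + 4) / 2 + 1 = (k + 1) + 2 by omega, show (2 * k + 4 + 1) / 2 = k + 2 by omega,
      show 2 * k + 4 = (2 * k + 2) + 2 by omega, aux, aux, aux]
    have : (2 * k + 2 + 1) ^ 2 = 2 * (k + 1) ^ 2 + 2 * (k + 1 + 1) ^ 2 - 1 := by
      zify [show 1 ≤ 2 * (k + 1) ^ 2 + 2 * (k + 1 + 1) ^ 2 by nlinarith]
      ring
    have : 1 ≤ (k + 1) ^ 2 := Nat.one_le_pow _ _ (by omega)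
    have : 1 ≤ (k + 1 + 1) ^ 2 := Nat.one_le_pow _ _ (by omega)
    omega

/-- Halve `J` and apply `commutator_shear_shear` with the spare coordinate `y`. Spare coordinates
persist: an element of one half serves the other, and `t` serves the shear of `y`. -/
theorem shear_coordProd_mem [Nonempty ι] (J : Finset ι) (t : ι) (h : ι → R → R) (ht : t ∉ J)
    (hy : J.card ≤ 2 ∨ ∃ y, y ≠ t ∧ y ∉ J) :
    shear t (coordProd J h) ∈ localPerms ι R ^ shearCost J.card := by
  induction hj : J.card using Nat.strong_induction_on generalizing J t h with
  | _ j ih =>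
    subst hj
    by_cases hJ : J.card ≤ 2
    · refine localPerms_pow_mono (j := 1) (le_max_left _ _) ?_
      rw [pow_one]
      have hI := ignoresCoord_coordProd ht h
      rcases (show J.card = 0 ∨ J.card = 1 ∨ J.card = 2 by omega) with h0 | h0 | h0
      · rw [Finset.card_eq_zero] at h0
        subst h0
        exact shear_mem_localPerms (c := t) (d := t) hI (fun _ _ => 1) fun x => rfl
      · obtain ⟨c, rfl⟩ := Finset.card_eq_one.1 h0
        exact shear_mem_localPerms (c := c) (d := c) hI (fun p _ => h c p) fun x => by
          rw [coordProd, Finset.prod_singleton]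
      · obtain ⟨c, d, hcd, rfl⟩ := Finset.card_eq_two.1 h0
        exact shear_mem_localPerms (c := c) (d := d) hI (fun p q => h c p * h d q) fun x => by
          rw [coordProd, Finset.prod_pair hcd]
    · obtain ⟨y, hyt, hyJ⟩ := hy.resolve_left hJ
      obtain ⟨J₁, hJ₁, hcard₁⟩ := Finset.exists_subset_card_eq
        (show (J.card + 1) / 2 ≤ J.card by omega)
      have hcard₂ : (J \ J₁).card = J.card / 2 := by
        rw [Finset.card_sdiff_of_subset hJ₁, hcard₁]
        omega
      have ht₁ : t ∉ J₁ := fun h' => ht (hJ₁ h')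
      have hy₁ : y ∉ J₁ := fun h' => hyJ (hJ₁ h')
      have ht₂ : t ∉ J \ J₁ := fun h' => ht (Finset.mem_sdiff.1 h').1
      have hy₂ : y ∉ J \ J₁ := fun h' => hyJ (Finset.mem_sdiff.1 h').1
      have hcard₃ : (insert y (J \ J₁)).card = J.card / 2 + 1 := by
        rw [Finset.card_insert_of_notMem hy₂, hcard₂]
      have hsplit : coordProd J h = fun x => coordProd J₁ h x * coordProd (J \ J₁) h x := by
        funext x
        rw [mul_comm]
        exact (Finset.prod_sdiff hJ₁).symm
      have hins : (fun x => x y * coordProd (J \ J₁) h x)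
          = coordProd (insert y (J \ J₁)) (update h y id) := by
        funext x
        rw [coordProd, coordProd, Finset.prod_insert hy₂, update_self, id]
        congr 1
        exact Finset.prod_congr rfl fun i hi => by
          rw [update_of_ne (ne_of_mem_of_not_mem hi hy₂)]
      rw [hsplit, ← commutator_shear_shear hyt (ignoresCoord_coordProd ht₁ h)
        (ignoresCoord_coordProd hy₁ h) (ignoresCoord_coordProd ht₂ h)
        (ignoresCoord_coordProd hy₂ h), hins]
      refine localPerms_pow_mono (shearCost_rec (by omega)) (commutator_mem_localPerms_pow ?_ ?_)
      · obtain ⟨z, hz⟩ : J₁.Nonempty := Finset.card_pos.1 (by omega)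
        refine ih (J.card / 2 + 1) (by omega) (insert y (J \ J₁)) t _ ?_ (Or.inr ⟨z, ?_, ?_⟩) hcard₃
        · rw [Finset.mem_insert, not_or]
          exact ⟨hyt.symm, ht₂⟩
        · exact fun h' => ht₁ (h' ▸ hz)
        · rw [Finset.mem_insert, not_or]
          exact ⟨fun h' => hy₁ (h' ▸ hz), fun h' => (Finset.mem_sdiff.1 h').2 hz⟩
      · exact ih _ (by omega) J₁ y _ hy₁ (Or.inr ⟨t, hyt.symm, ht₁⟩) hcard₁

/-- If `2` is a unit, then the zero test on all other coordinates can be added to a coordinate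
although no coordinate is left over. -/
theorem shear_zeroTest_mem [DecidableEq R] [Nonempty ι] [Nontrivial R] (h2 : IsUnit (2 : R))
    {a b : ι} (hab : a ≠ b)
    {A B : Finset ι} (haA : a ∉ A) (hbA : b ∉ A) (haB : a ∉ B) (hbB : b ∉ B)
    (hAB : Disjoint A B) (hA : A.Nonempty) :
    shear b (zeroTest (insert a (A ∪ B)) : (ι → R) → R) ∈
      localPerms ι R ^ (4 + 4 * shearCost A.card + 2 * shearCost (B.card + 1)) := by
  obtain ⟨w, hw⟩ := h2
  -- The inner commutator scales `b` by 2 if `x a = 0` and `A` vanishes, and by 1 if `x a = 0` and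
  -- `A` does not. Other values of `x a` are masked by the test on `insert a B`, so the outer
  -- commutator adds `(2 - 1)` times the full test.
  let u : (ι → R) → Rˣ := fun x => if x a = 0 then w else 1
  have hu : IgnoresCoord b u := fun x v => by simp only [u, update_of_ne hab]
  have hf (t : ι) (ht : t ∉ A) : IgnoresCoord t (zeroTest A : (ι → R) → R) :=
    ignoresCoord_coordProd ht _
  have hbaB : b ∉ insert a B := by
    rw [Finset.mem_insert, not_or]
    exact ⟨hab.symm, hbB⟩
  have hg : IgnoresCoord b (zeroTest (insert a B) : (ι → R) → R) := ignoresCoord_coordProd hbaB _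
  have hv : IgnoresCoord b (fun x : ι → R => u x * (u (update x a (x a - zeroTest A x)))⁻¹) :=
    fun x v => by
      simp only [hu x v, hf b hbA x v, update_comm hab.symm, update_of_ne hab, hu _ v]
  have hu_mem : scale b u ∈ localPerms ι R :=
    ⟨⟨b, a, a, fun (s p _ : R) => ((if p = 0 then w else 1 : Rˣ) : R) * s, fun x => scale_apply hu x⟩,
      ⟨b, a, a, fun (s p _ : R) => (((if p = 0 then w else 1 : Rˣ)⁻¹ : Rˣ) : R) * s,
        fun x => scale_inv_apply hu x⟩⟩
  have key : shear b (zeroTest (insert a (A ∪ B)) : (ι → R) → R)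
      = ⁅⁅scale b u, shear a (zeroTest A : (ι → R) → R)⁆,
          shear b (zeroTest (insert a B) : (ι → R) → R)⁆ := by
    rw [commutator_scale_shear hab hu (hf a haA) (hf b hbA), commutator_scale_shear_same hv hg]
    congr 1
    funext x
    have haAB : a ∉ A ∪ B := by
      rw [Finset.mem_union, not_or]
      exact ⟨haA, haB⟩
    have e1 : zeroTest (insert a (A ∪ B)) x
        = zeroIndicator (x a) * (zeroTest A x * zeroTest B x) := by
      simp only [zeroTest, coordProd]
      rw [Finset.prod_insert haAB, Finset.prod_union hAB]
    have e2 : zeroTest (insert a B) x = zeroIndicator (x a) * zeroTest B x := by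
      simp only [zeroTest, coordProd]
      rw [Finset.prod_insert haB]
    simp only [e1, e2, u, update_self]
    by_cases hxa : x a = 0
    · rw [zeroTest_apply A]
      split_ifs with hxA h
      · simp [hxa] at h
      · rw [inv_one, mul_one, hw]
        ring
      · simp
      · simp_all
    · simp [hxa, zeroIndicator]
  rw [key, show 4 + 4 * shearCost A.card + 2 * shearCost (B.card + 1)
    = 2 * (2 * 1 + 2 * shearCost A.card) + 2 * shearCost (B.card + 1) by ring]
  refine commutator_mem_localPerms_pow (commutator_mem_localPerms_pow ?_ ?_) ?_
  · rwa [pow_one]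
  · exact shear_coordProd_mem _ _ _ haA (Or.inr ⟨b, hab.symm, hbA⟩)
  · rw [← Finset.card_insert_of_notMem haB]
    -- An element of `A` is the spare coordinate for the test on `insert a B`.
    obtain ⟨z, hz⟩ := hA
    refine shear_coordProd_mem _ _ _ hbaB (Or.inr ⟨z, fun h => hbA (h ▸ hz), ?_⟩)
    rw [Finset.mem_insert, not_or]
    exact ⟨fun h => haA (h ▸ hz), Finset.disjoint_left.1 hAB hz⟩

end Shear

/-! ### The odometer as a short product of local permutations -/

section Increment

open scoped Pointwise

variable {m : ℕ}

/-- The bound for the number of local permutations whose product increments a number with `M + 1`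
digits. -/
def incrementCost (M : ℕ) : ℕ :=
  4 + 4 * shearCost ((M - 1) / 2) + 2 * shearCost (M - 1 - (M - 1) / 2 + 1)
    + ∑ j ∈ Finset.range M, shearCost j

theorem two_mul_shearCost_le (j : ℕ) : 2 * shearCost (j + 1) ≤ 3 * j ^ 2 + 2 := by
  rw [shearCost, Nat.add_sub_cancel]
  rcases max_cases 1 ((3 * j ^ 2 - 1) / 2) with h | h <;> omega

theorem four_mul_incrementCost_le {M : ℕ} (hM : 3 ≤ M) :
    4 * incrementCost M ≤ 2 * M ^ 3 + 9 * M ^ 2 + 18 := by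
  have hsum : ∀ L : ℕ, 2 * ∑ j ∈ Finset.range (L + 1), shearCost j ≤ (L + 1) ^ 3 + 1 := by
    intro L
    induction L with
    | zero => simp [shearCost]
    | succ L ih =>
      rw [Finset.sum_range_succ, mul_add]
      have := two_mul_shearCost_le L
      have : (L + 1 + 1) ^ 3 = (L + 1) ^ 3 + 3 * L ^ 2 + 9 * L + 7 := by ring
      omega
  have h1 : 2 * ∑ j ∈ Finset.range M, shearCost j ≤ M ^ 3 + 1 := by
    simpa [Nat.sub_add_cancel (show 1 ≤ M by omega)] using hsum (M - 1)
  have h2 : 4 * (4 * shearCost ((M - 1) / 2) + 2 * shearCost (M - 1 - (M - 1) / 2 + 1))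
      ≤ 9 * M ^ 2 := by
    obtain ⟨s, rfl | rfl⟩ : ∃ s, M = 2 * s + 3 ∨ M = 2 * s + 4 := ⟨(M - 3) / 2, by omega⟩
    · rw [show (2 * s + 3 - 1) / 2 = s + 1 by omega,
        show 2 * s + 3 - 1 - (s + 1) + 1 = (s + 1) + 1 by omega]
      have := two_mul_shearCost_le s
      have := two_mul_shearCost_le (s + 1)
      nlinarith
    · rw [show (2 * s + 4 - 1) / 2 = s + 1 by omega,
        show 2 * s + 4 - 1 - (s + 1) + 1 = (s + 2) + 1 by omega]
      have := two_mul_shearCost_le s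
      have := two_mul_shearCost_le (s + 2)
      nlinarith
  rw [incrementCost]
  omega

/-- The effect of the carry on digit `j`, once the lower digits have been incremented. -/
theorem shear_zeroTest_apply {N : ℕ} (j : Fin N) (x y : Fin N → ZMod m)
    (hy : ∀ i, y i = if i < j then increment x i else x i) (i : Fin N) :
    shear j (zeroTest (Finset.Iio j)) y i = if i ≤ j then increment x i else x i := by
  have hI : IgnoresCoord j (zeroTest (Finset.Iio j) : (Fin N → ZMod m) → ZMod m) :=
    ignoresCoord_coordProd (by simp) _
  rw [shear_apply hI]
  have hc : zeroTest (Finset.Iio j) y = carry x j := by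
    rw [zeroTest_apply, carry]
    congr 1
    rw [← increment_eq_zero_iff]
    simp only [Finset.mem_Iio, eq_iff_iff]
    exact forall₂_congr fun k hk => by rw [hy, if_pos hk]
  by_cases hij : i = j
  · subst hij
    rw [update_self, hc, hy, if_neg (lt_irrefl _), if_pos le_rfl, increment]
  · rw [update_of_ne hij, hy]
    simp only [le_iff_lt_or_eq, hij, or_false]

/-- Digits are incremented from the least significant upwards, each by a zero test on the new lower
digits. The room left by `M + 1 ≤ N` supplies the spare coordinate. -/
theorem exists_partial_increment {N : ℕ} (M : ℕ) (hM : M + 1 ≤ N) :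
    ∃ σ ∈ localPerms (Fin N) (ZMod m) ^ ∑ j ∈ Finset.range M, shearCost j,
      ∀ x i, σ x i = if (i : ℕ) < M then increment x i else x i := by
  induction M with
  | zero => exact ⟨1, by simp, fun x i => by simp⟩
  | succ M ih =>
    obtain ⟨σ, hσ, h⟩ := ih (by omega)
    let j : Fin N := ⟨M, by omega⟩
    have : Nonempty (Fin N) := ⟨j⟩
    refine ⟨shear j (zeroTest (Finset.Iio j)) * σ, ?_, fun x i => ?_⟩
    · rw [Finset.sum_range_succ, add_comm, pow_add]
      refine Set.mul_mem_mul ?_ hσ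
      have := shear_coordProd_mem (R := ZMod m) (Finset.Iio j) j (fun _ => zeroIndicator) (by simp)
        (Or.inr ⟨⟨M + 1, by omega⟩, by simp [j], by simp [j]⟩)
      rwa [Fin.card_Iio] at this
    · rw [Perm.mul_apply, shear_zeroTest_apply j x (σ x) (h x)]
      simp only [Fin.le_def, j, Nat.lt_succ_iff]

theorem odometer_mem_localPerms_pow [NeZero m] (hm : Odd m) (hm1 : 1 < m) {M : ℕ} (hM : 3 ≤ M) :
    odometer m (M + 1) ∈ localPerms (Fin (M + 1)) (ZMod m) ^ incrementCost M := by
  have : Fact (1 < m) := ⟨hm1⟩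
  have h2 : IsUnit (2 : ZMod m) := by
    have := (ZMod.isUnit_iff_coprime 2 m).2 (Nat.coprime_two_left.2 hm)
    simpa using this
  obtain ⟨σ, hσ, h⟩ := exists_partial_increment (m := m) (N := M + 1) M le_rfl
  let b : Fin (M + 1) := ⟨M, by omega⟩
  let a : Fin (M + 1) := ⟨M - 1, by omega⟩
  let p : Fin (M + 1) := ⟨(M - 1) / 2, by omega⟩
  -- For the top digit `b`, the next digit plays the role of `a`, and the remaining ones are split
  -- into nearly equal sets.
  have hset : Finset.Iio b = insert a (Finset.Iio p ∪ Finset.Ico p a) := by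
    ext i
    simp only [Finset.mem_Iio, Finset.mem_insert, Finset.mem_union, Finset.mem_Ico, Fin.lt_def,
      Fin.le_def, Fin.ext_iff, a, b, p]
    omega
  have hlast : shear b (zeroTest (Finset.Iio b) : (Fin (M + 1) → ZMod m) → ZMod m) ∈
      localPerms (Fin (M + 1)) (ZMod m) ^
        (4 + 4 * shearCost ((M - 1) / 2) + 2 * shearCost (M - 1 - (M - 1) / 2 + 1)) := by
    have := shear_zeroTest_mem (R := ZMod m) h2 (a := a) (b := b) (A := Finset.Iio p)
      (B := Finset.Ico p a)
      (by simp only [ne_eq, Fin.ext_iff, a, b]; omega)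
      (by simp only [Finset.mem_Iio, Fin.lt_def, a, p]; omega)
      (by simp only [Finset.mem_Iio, Fin.lt_def, b, p]; omega)
      (by simp)
      (by simp only [Finset.mem_Ico, Fin.lt_def, Fin.le_def, a, b, p]; omega)
      (Finset.disjoint_left.2 fun i hi hi' => by
        rw [Finset.mem_Iio] at hi
        exact absurd (Finset.mem_Ico.1 hi').1 (not_le.2 hi))
      ⟨0, by simp only [Finset.mem_Iio, Fin.lt_def, p, Fin.val_zero]; omega⟩
    rwa [Fin.card_Iio, Fin.card_Ico, ← hset] at this
  have hprod : odometer m (M + 1) = shear b (zeroTest (Finset.Iio b)) * σ := by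
    ext x i
    rw [Perm.mul_apply, shear_zeroTest_apply b x (σ x) (h x), odometer_apply,
      if_pos (show i ≤ b from Nat.lt_succ_iff.1 i.2)]
  rw [hprod, incrementCost, pow_add]
  exact Set.mul_mem_mul hlast hσ

end Increment

/-! ### Assembling the counter and choosing the pointer size -/

section Main

open scoped Pointwise

theorem exists_partial_products {G : Type*} [Group G] {S : Set G} {K : ℕ} {σ : G}
    (hσ : σ ∈ S ^ K) : ∃ s T : ℕ → G, (∀ k < K, s k ∈ S) ∧ T 0 = 1 ∧
      (∀ k < K, T (k + 1) = s k * T k) ∧ T K = σ := by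
  induction K generalizing σ with
  | zero =>
    rw [pow_zero, Set.mem_one] at hσ
    exact ⟨fun _ => 1, fun _ => 1, by simp, rfl, by simp, hσ.symm⟩
  | succ K ih =>
    rw [pow_succ'] at hσ
    obtain ⟨a, ha, b, hb, rfl⟩ := Set.mem_mul.1 hσ
    obtain ⟨s, T, hs, hT0, hT, hTK⟩ := ih hb
    refine ⟨update s K a, update T (K + 1) (a * b), fun k hk => ?_, ?_, fun k hk => ?_, ?_⟩
    · rcases Nat.lt_succ_iff_lt_or_eq.1 hk with h | rfl
      · rw [update_of_ne h.ne]
        exact hs k h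
      · rwa [update_self]
    · rw [update_of_ne (by omega), hT0]
    · rw [update_of_ne (show k ≠ K + 1 by omega)]
      rcases Nat.lt_succ_iff_lt_or_eq.1 hk with h | rfl
      · rw [update_of_ne (show k + 1 ≠ K + 1 by omega), update_of_ne h.ne, hT k h]
      · rw [update_self, update_self, hTK]
    · rw [update_self]

/-- A Gray code counter in `r` coordinates that points to the next factor of a product of `m ^ r`
local permutations of the other coordinates. -/
theorem exists_counter_of_mem_pow {m r N : ℕ} [NeZero m] (hr : 0 < r)
    {σ : Perm (Fin N → ZMod m)} (hσ : IsFullCycle σ)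
    (hmem : σ ∈ localPerms (Fin N) (ZMod m) ^ m ^ r) :
    ∃ C : Counter (Fin (r + N) → ZMod m), C.SpaceOptimal ∧ C.IsGrayCode 2 ∧
      (∃ T : DAT (ZMod m) (r + N), T.ComputesNext C ∧ T.read ≤ r + 3 ∧ T.write ≤ 2) ∧
      (∃ T : DAT (ZMod m) (r + N), T.ComputesPrev C ∧ T.read ≤ r + 3 ∧ T.write ≤ 2) := by
  obtain ⟨g, hg, hg1, hg2⟩ := exists_gray_perm (m := m) hr
  obtain ⟨s, T, hs, hT0, hT, hTK⟩ := exists_partial_products hmem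
  have hcard : Fintype.card (Fin r → ZMod m) = m ^ r := by
    rw [Fintype.card_fun, ZMod.card, Fintype.card_fin]
  -- `idx p` is the time at which the Gray code started at 0 reaches `p`.
  choose idx hidx_lt hidx using hg.exists_pow_eq 0
  let S : (Fin r → ZMod m) → Perm (Fin N → ZMod m) := fun p => s (idx p)
  have hS : ∀ p, S p ∈ localPerms (Fin N) (ZMod m) := fun p => hs _ (hcard ▸ hidx_lt p)
  have hfull : IsFullCycle (Equiv.prodShear g S : Perm _) :=
    hg.prodShear S 0 T hT0 (fun k hk => by
      rw [hT k (hcard ▸ hk)]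
      simp only [S]
      rw [hg.pow_apply_inj 0 (hidx_lt _) hk (hidx _)]) (by rwa [hcard, hTK])
  let e : (Fin r → ZMod m) × (Fin N → ZMod m) ≃ (Fin (r + N) → ZMod m) := Fin.appendEquiv r N
  let f : Perm (Fin (r + N) → ZMod m) := e.permCongr (Equiv.prodShear g S)
  have hf : ∀ p x, f (Fin.append p x) = Fin.append (g p) (S p x) := fun p x => by
    change e (Equiv.prodShear g S (e.symm (e (p, x)))) = _
    rw [e.symm_apply_apply]
    rfl
  have hf' : ∀ p x, f⁻¹ (Fin.append p x) = Fin.append (g⁻¹ p) ((S (g⁻¹ p))⁻¹ x) := fun p x => by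
    rw [Perm.inv_eq_iff_eq, hf]
    congr 1
    · exact (g.apply_symm_apply p).symm
    · exact ((S (g⁻¹ p)).apply_symm_apply x).symm
  have happ : ∀ w : Fin (r + N) → ZMod m, ∃ p x, w = Fin.append p x := fun w => by
    obtain ⟨⟨p, x⟩, rfl⟩ := e.surjective w
    exact ⟨p, x, rfl⟩
  obtain ⟨C, hC, hnext, hprev⟩ :=
    (hfull.of_semiconj (g := f) e fun ⟨p, x⟩ => (hf p x).symm).exists_counter
  obtain ⟨T₁, hT₁, hread₁, hwrite₁⟩ := DAT.exists_dat_append (fun p x => (g p, S p x)) fun p => by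
    obtain ⟨i, a, hi⟩ := hg1 p
    obtain ⟨t, c, d, φ, hφ⟩ := (hS p).1
    exact ⟨i, a, t, c, d, φ, fun x => by rw [hi, hφ]⟩
  obtain ⟨T₂, hT₂, hread₂, hwrite₂⟩ :=
    DAT.exists_dat_append (fun p x => (g⁻¹ p, (S (g⁻¹ p))⁻¹ x)) fun p => by
      obtain ⟨i, a, hi⟩ := hg2 p
      obtain ⟨t, c, d, φ, hφ⟩ := (hS (g⁻¹ p)).2
      exact ⟨i, a, t, c, d, φ, fun x => by rw [hφ, hi]⟩
  have hcomp : T₁.ComputesNext C := fun w => by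
    rw [hnext]
    obtain ⟨p, x, hw⟩ := happ w.1
    rw [hw, hT₁, hf]
  refine ⟨C, hC, fun i => ?_, ⟨T₁, hcomp, hread₁, hwrite₁⟩, ⟨T₂, fun w => ?_, hread₂, hwrite₂⟩⟩
  · rw [← C.next_word i, ← hcomp]
    exact (T₁.hammingDist_run_le_write _).trans hwrite₁
  · rw [hprev]
    obtain ⟨p, x, hw⟩ := happ w.1
    rw [hw, hT₂, hf']

theorem pow_four_lt_three_pow {n : ℕ} (hn : 15 ≤ n) : n ^ 4 < 3 ^ n := by
  induction n, hn using Nat.le_induction with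
  | base => norm_num
  | succ n hn ih =>
    have h : (n + 1) ^ 4 ≤ 3 * n ^ 4 := by
      have h2 : (n + 1) ^ 2 * 4 ≤ 5 * n ^ 2 := by nlinarith
      nlinarith [Nat.mul_le_mul h2 h2]
    rw [pow_succ 3]
    omega

/-- The choice of the number of pointer coordinates. -/
theorem exists_pointer_size {m n : ℕ} (hm : Odd m) (hm1 : 1 < m) (hn : 15 ≤ n)
    (hmn : m = 3 ∨ m ^ 4 ≤ n) :
    ∃ r M, n = r + (M + 1) ∧ 0 < r ∧ 3 ≤ M ∧ m ^ (r + 3) ≤ n ^ 4 ∧ incrementCost M ≤ m ^ r := by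
  have hm3 : 3 ≤ m := by
    obtain ⟨k, rfl⟩ := hm
    omega
  have hlt : Nat.log m (n ^ 4) < n :=
    Nat.log_lt_of_lt_pow (by positivity)
      ((pow_four_lt_three_pow hn).trans_le (Nat.pow_le_pow_left hm3 n))
  -- This gives `r ≥ 6`, hence the gap `M + 7 ≤ n` used below.
  have hge : 9 ≤ Nat.log m (n ^ 4) := by
    refine Nat.le_log_of_pow_le hm1 ?_
    rcases hmn with rfl | h
    · exact le_trans (by norm_num) (Nat.pow_le_pow_left hn 4)
    · calc m ^ 9 ≤ m ^ (4 * 4) := Nat.pow_le_pow_right (by omega) (by norm_num)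
        _ = (m ^ 4) ^ 4 := pow_mul _ _ _
        _ ≤ n ^ 4 := Nat.pow_le_pow_left h 4
  have hle : m ^ Nat.log m (n ^ 4) ≤ n ^ 4 := Nat.pow_log_le_self m (by positivity)
  have hup : n ^ 4 < m ^ (Nat.log m (n ^ 4)).succ := Nat.lt_pow_succ_log_self hm1 _
  obtain ⟨r, hr⟩ : ∃ r, Nat.log m (n ^ 4) = r + 3 := ⟨_, (Nat.sub_add_cancel (by omega)).symm⟩
  rw [hr] at hlt hge hle hup
  obtain ⟨M, hM⟩ : ∃ M, n = r + (M + 1) := ⟨n - r - 1, by omega⟩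
  have hM3 : 3 ≤ M := by omega
  refine ⟨r, M, hM, by omega, hM3, hle, ?_⟩
  have hcost := four_mul_incrementCost_le hM3
  have hMn : M + 7 ≤ n := by omega
  rw [show (r + 3).succ = r + 4 from rfl, pow_add] at hup
  rcases hmn with rfl | h
  · have h1 : (M + 7) ^ 4 ≤ n ^ 4 := Nat.pow_le_pow_left hMn 4
    -- Here `n ^ 4 < 81 * 3 ^ r`, so 81 times the cost bound is compared with a quartic. The square
    -- in the hint absorbs the negative cubic term.
    have h2 : 81 * (2 * M ^ 3 + 9 * M ^ 2 + 18) ≤ 4 * (M + 7) ^ 4 := by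
      zify
      nlinarith [mul_nonneg (sq_nonneg (M : ℤ)) (sq_nonneg (4 * (M : ℤ) - 25)),
        sq_nonneg (M : ℤ), Int.natCast_nonneg M]
    omega
  -- Since `m ^ 4 ≤ n`, the rounding loss in the logarithm costs at most one factor `n`, and a cubic
  -- bound suffices.
  · have h1 : n ^ 3 < m ^ r := by
      have : n * n ^ 3 < n * m ^ r := by
        calc n * n ^ 3 = n ^ 4 := by ring
          _ < m ^ r * m ^ 4 := hup
          _ ≤ m ^ r * n := Nat.mul_le_mul_left _ h
          _ = n * m ^ r := mul_comm _ _
      exact lt_of_mul_lt_mul_left this (Nat.zero_le n)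
    have h2 : (M + 7) ^ 3 ≤ n ^ 3 := Nat.pow_le_pow_left hMn 3
    have h3 : 2 * M ^ 3 + 9 * M ^ 2 + 18 ≤ 4 * (M + 7) ^ 3 := by nlinarith
    omega

end Main

theorem theorem1 (m n : ℕ) [NeZero m] (hm : Odd m) (hm1 : 1 < m) (hn : 15 ≤ n)
    (hmn : m = 3 ∨ m ^ 4 ≤ n) :
    ∃ C : Counter (Fin n → ZMod m),
      C.SpaceOptimal ∧ C.IsGrayCode 2 ∧
      (∃ T : DAT (ZMod m) n,
        T.ComputesNext C ∧ (T.read : ℝ) ≤ 4 * Real.logb m n ∧ T.write ≤ 2) ∧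
      (∃ T : DAT (ZMod m) n,
        T.ComputesPrev C ∧ (T.read : ℝ) ≤ 4 * Real.logb m n ∧ T.write ≤ 2) := by
  obtain ⟨r, M, rfl, hr, hM, hpow, hcost⟩ := exists_pointer_size hm hm1 hn hmn
  have hread : ∀ k : ℕ, k ≤ r + 3 → (k : ℝ) ≤ 4 * Real.logb m (r + (M + 1) : ℕ) := by
    intro k hk
    have hm1' : (1 : ℝ) < m := by exact_mod_cast hm1
    rw [show (4 : ℝ) = (4 : ℕ) by norm_num, ← Real.logb_pow,
      Real.le_logb_iff_rpow_le hm1' (by positivity), Real.rpow_natCast]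
    exact_mod_cast (Nat.pow_le_pow_right (by omega) hk).trans hpow
  obtain ⟨C, hC, hgray, ⟨T₁, h₁, hr₁, hw₁⟩, ⟨T₂, h₂, hr₂, hw₂⟩⟩ :=
    exists_counter_of_mem_pow hr (isFullCycle_odometer (m := m) (M + 1))
      (localPerms_pow_mono hcost (odometer_mem_localPerms_pow hm hm1 hM))
  exact ⟨C, hC, hgray, ⟨T₁, h₁, hread _ hr₁, hw₁⟩, ⟨T₂, h₂, hread _ hr₂, hw₂⟩⟩
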